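/- Let $(I,\le)$ be a finite partially ordered set with $|I|\ge 2$. For each $i\in I$ let $\Delta_i$ be a finite set with at least two elements, and let $\mathrm{Sym}(\Delta_i)$ act naturally on $\Delta_i$. Put $A(i)=\{j\in I: j>i\}$, $\Delta=\prod_{i\in I}\Delta_i$ and $\Delta_{A(i)}=\prod_{j>i}\Delta_j$ (a one-point set if $A(i)=\emptyset$), and let $F$ be the generalised wreath product of the permutation groups $(\mathrm{Sym}(\Delta_i),\Delta_i)_{i\in I}$; that is, $F$ is the set of all families $f=(f_i)_{i\in I}$ of functions $f_i:\Delta_{A(i)}\to \mathrm{Sym}(\Delta_i)$, acting on $\Delta$ by $$(f\cdot\delta)_i=f_i\big((\delta_j)_{j>i}\big)(\delta_i)\qquad(i\in I,\ \delta\in\Delta),$$ with the group operation given by composition of these maps; explicitly, $(fh)_i(\omega)=f_i(h\cdot\omega)\,h_i(\omega)$ for $\omega\in\Delta_{A(i)}$, where $h$ acts on $\Delta_{A(i)}$ by the same formula, restricted to the coordinates $j>i$. Then the minimum number $d(F)$ of generators of $F$ is $$d(F)=|I|.$$ -/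

import Mathlib

/-- The elements of the generalised wreath product of the groups `G i` acting on the sets `Δ i`,
indexed by a partially ordered set `I`: families `f = (f i)`, where `f i` is a function from
`∏_{j > i} Δ j` to `G i`. -/
@[ext]
structure GenWreath {I : Type*} [PartialOrder I] (G : I → Type*) (Δ : I → Type*) where
  /-- The component of `f` at `i`. -/
  comp : ∀ i : I, ((j : {j : I // i < j}) → Δ j) → G i

namespace GenWreath

variable {I : Type*} [PartialOrder I] {G : I → Type*} {Δ : I → Type*}

/-- The projection of a point of `∏_{k > i} Δ k` to `∏_{k > j} Δ k`, where `i < j`. -/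
def restrict {i j : I} (hij : i < j) (ω : (k : {k : I // i < k}) → Δ k) :
    (k : {k : I // j < k}) → Δ k :=
  fun k => ω ⟨k, hij.trans k.2⟩

/-- The projection of a point of `∏_k Δ k` to `∏_{k > i} Δ k`. -/
def proj (i : I) (δ : (k : I) → Δ k) : (k : {k : I // i < k}) → Δ k :=
  fun k => δ k

variable [∀ i, Group (G i)]

instance : One (GenWreath G Δ) := ⟨⟨fun _ _ => 1⟩⟩

theorem one_comp (i : I) (ω : (j : {j : I // i < j}) → Δ j) :
    (1 : GenWreath G Δ).comp i ω = 1 := rfl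

variable [∀ i, MulAction (G i) (Δ i)]

/-- The map that `f` induces on `∏_{j > i} Δ j`. -/
def actAbove (f : GenWreath G Δ) (i : I) (ω : (j : {j : I // i < j}) → Δ j) :
    (j : {j : I // i < j}) → Δ j :=
  fun j => f.comp j (restrict j.2 ω) • ω j

/-- The map that `f` induces on `∏_i Δ i`. -/
def act (f : GenWreath G Δ) (δ : (i : I) → Δ i) : (i : I) → Δ i :=
  fun i => f.comp i (proj i δ) • δ i

/-- The product: `f * h` acts as `h` followed by `f`. -/
instance : Mul (GenWreath G Δ) :=
  ⟨fun f h => ⟨fun i ω => f.comp i (h.actAbove i ω) * h.comp i ω⟩⟩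

/-- The components of the inverse, by recursion from the top of `I` downwards. -/
def invComp [WellFoundedGT I] (f : GenWreath G Δ) (i : I)
    (ω : (j : {j : I // i < j}) → Δ j) : G i :=
  (f.comp i (fun j => invComp f j.1 (restrict j.2 ω) • ω j))⁻¹
termination_by wellFounded_gt.wrap i
decreasing_by exact j.2

instance [WellFoundedGT I] : Inv (GenWreath G Δ) := ⟨fun f => ⟨f.invComp⟩⟩

theorem mul_comp (f h : GenWreath G Δ) (i : I) (ω : (j : {j : I // i < j}) → Δ j) :
    (f * h).comp i ω = f.comp i (h.actAbove i ω) * h.comp i ω := rfl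

theorem one_actAbove (i : I) (ω : (j : {j : I // i < j}) → Δ j) :
    (1 : GenWreath G Δ).actAbove i ω = ω := by
  funext j
  simp [actAbove, one_comp]

theorem mul_actAbove (f h : GenWreath G Δ) (i : I) (ω : (j : {j : I // i < j}) → Δ j) :
    (f * h).actAbove i ω = f.actAbove i (h.actAbove i ω) := by
  funext j
  simp only [actAbove, mul_comp, mul_smul]
  rfl

theorem inv_comp [WellFoundedGT I] (f : GenWreath G Δ) (i : I)
    (ω : (j : {j : I // i < j}) → Δ j) :
    (f⁻¹).comp i ω = (f.comp i ((f⁻¹).actAbove i ω))⁻¹ := by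
  change invComp f i ω = _
  rw [invComp]
  rfl

instance [WellFoundedGT I] : Group (GenWreath G Δ) :=
  Group.ofRightAxioms
    (fun f g h => by
      ext i ω
      simp only [mul_comp, mul_actAbove, mul_assoc])
    (fun f => by
      ext i ω
      simp only [mul_comp, one_actAbove, one_comp, mul_one])
    (fun f => by
      ext i ω
      simp only [mul_comp, inv_comp f i ω, mul_inv_cancel, one_comp])

/-- The action of the generalised wreath product on `Δ = ∏_i Δ i`. -/
instance [WellFoundedGT I] : MulAction (GenWreath G Δ) ((i : I) → Δ i) where
  smul := act
  one_smul δ := by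
    funext i
    exact one_smul (G i) (δ i)
  mul_smul f h δ := by
    funext i
    exact mul_smul (f.comp i (h.actAbove i (proj i δ))) (h.comp i (proj i δ)) (δ i)

instance [Finite I] [∀ i, Finite (G i)] [∀ i, Finite (Δ i)] : Finite (GenWreath G Δ) :=
  Finite.of_injective comp (fun _ _ h => GenWreath.ext h)

end GenWreath

/-! Lower bound: for each index the product of the signs of all values of the component is a
homomorphism to ±1, because every element permutes the points at which that component is evaluated.
Together these map onto a product of |I| groups of order 2, which needs |I| generators.

Upper bound: build the group from the top of the poset, adding minimal indices. Each new index `i`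
costs one generator (`exists_closure_eq_supported_insert`): multiply an old generator by a full
cycle `c` placed at one point `ω`, and add an adjacent transposition at `ω`. A power of the modified
generator fixes `ω` and acts there as `c`, so all of `Sym(Δ i)` is obtained at `ω`, and transitivity
spreads it to all points. A single index may already need two generators, so the induction starts
from two indices, where two generators suffice (`exists_closure_eq_supported_pair`): an involution
at one index is coupled with an element of odd order at the other, and a power separates them. -/

/-! ### Generating finite symmetric groups. -/

open scoped Classical in
/-- A subgroup of a finite symmetric group containing a transposition and stable under conjugation
by a set of generators is everything. -/
theorem Subgroup.eq_top_of_swap_mem_of_conj_mem {α : Type*} [Finite α]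
    {L : Subgroup (Equiv.Perm α)} {c : Equiv.Perm α} {a b : α} (hab : a ≠ b)
    (hgen : Subgroup.closure {c, Equiv.swap a b} = ⊤) (hs : Equiv.swap a b ∈ L)
    (hc : ∀ π ∈ L, c * π * c⁻¹ ∈ L) : L = ⊤ := by
  have hnorm : ∀ g : Equiv.Perm α, ∀ π ∈ L, g * π * g⁻¹ ∈ L := by
    have hset : ∀ s ∈ ({c, Equiv.swap a b} : Set (Equiv.Perm α)), ∀ π ∈ L, s * π * s⁻¹ ∈ L := by
      rintro s (rfl | rfl) π hπ
      · exact hc π hπ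
      · exact L.mul_mem (L.mul_mem hs hπ) (L.inv_mem hs)
    intro g
    -- By finiteness, words without inverses suffice; stability is known only under the generators
    -- themselves.
    have hg : g ∈ Submonoid.closure ({c, Equiv.swap a b} : Set (Equiv.Perm α)) := by
      rw [← Subgroup.closure_toSubmonoid_of_finite, hgen]
      trivial
    induction hg using Submonoid.closure_induction with
    | mem s h => exact hset s h
    | one => simp
    | mul x y _ _ hx hy =>
      intro π hπ
      have := hx _ (hy π hπ)
      simpa [mul_assoc] using this
  rw [eq_top_iff, ← Equiv.Perm.closure_isSwap, Subgroup.closure_le]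
  rintro σ ⟨x, y, hxy, rfl⟩
  obtain ⟨g, hg⟩ := isConj_iff.1 (Equiv.Perm.isConj_swap hab hxy)
  rw [← hg]
  exact hnorm g _ hs

open scoped Classical in
/-- A nontrivial finite type has a cycle without fixed points, which together with any
transposition of adjacent points generates the symmetric group. -/
theorem Equiv.Perm.exists_isCycle_forall_ne (α : Type*) [Finite α] [Nontrivial α] :
    ∃ c : Equiv.Perm α, c.IsCycle ∧ (∀ x, c x ≠ x) ∧
      ∀ x, Subgroup.closure {c, Equiv.swap x (c x)} = ⊤ := by
  have := Fintype.ofFinite α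
  obtain ⟨c, hc, -⟩ := Finset.exists_cycleOn (Finset.univ : Finset α)
  have hcyc : c.IsCycle := Equiv.Perm.isCycle_iff_exists_isCycleOn.2
    ⟨_, by simpa using Set.nontrivial_univ, hc, fun x _ => by simp⟩
  have hne : ∀ x, c x ≠ x := fun x =>
    hc.apply_ne (by simpa using Set.nontrivial_univ) (by simp)
  refine ⟨c, hcyc, hne, fun x => ?_⟩
  exact Equiv.Perm.closure_cycle_adjacent_swap hcyc
    (Finset.eq_univ_of_forall fun x => by simpa using hne x) x

open scoped Classical in
/-- A finite symmetric group has a pair of generators, one of which has odd order. -/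
theorem Equiv.Perm.exists_odd_order_generating_pair (α : Type*) [Finite α] [Nontrivial α] :
    ∃ (c τ : Equiv.Perm α) (n : ℕ), Odd n ∧ c ^ n = 1 ∧ Subgroup.closure {c, τ} = ⊤ := by
  have := Fintype.ofFinite α
  obtain ⟨r, hcyc, hne, hgen⟩ := Equiv.Perm.exists_isCycle_forall_ne α
  obtain ⟨a⟩ : Nonempty α := inferInstance
  rcases Nat.even_or_odd (Fintype.card α) with hev | hodd
  swap
  · refine ⟨r, _, _, hodd, ?_, hgen a⟩
    have : r.support = Finset.univ := Finset.eq_univ_of_forall fun x => by simpa using hne x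
    rw [← Finset.card_univ, ← this, ← hcyc.orderOf, pow_orderOf_eq_one]
  -- For even cardinality, multiplying by `τ` removes one point from the cycle: a cycle of odd
  -- length remains, or the identity when there are only two points.
  set τ := Equiv.swap a (r a) with hτ
  have hgen' : Subgroup.closure {τ * r, τ} = ⊤ := by
    rw [eq_top_iff, ← hgen a, Subgroup.closure_le]
    have h1 : τ * r ∈ Subgroup.closure {τ * r, τ} := Subgroup.subset_closure (by simp)
    have h2 : τ ∈ Subgroup.closure {τ * r, τ} := Subgroup.subset_closure (by simp)
    rintro s (rfl | rfl)
    · simpa using Subgroup.mul_mem _ (Subgroup.inv_mem _ h2) h1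
    · exact h2
  have hsupp : r.support = Finset.univ := Finset.eq_univ_of_forall fun x => by simpa using hne x
  by_cases h : r (r a) = a
  · refine ⟨τ * r, τ, 1, odd_one, ?_, hgen'⟩
    rw [pow_one, hcyc.eq_swap_of_apply_apply_eq_self (hne a) h]
    simp [hτ]
  · have hcyc' : (τ * r).IsCycle := hcyc.swap_mul (hne a) h
    refine ⟨τ * r, τ, (τ * r).support.card, ?_, ?_, hgen'⟩
    · have h1 := hcyc'.sign
      rw [Equiv.Perm.sign_mul, hcyc.sign, Equiv.Perm.sign_swap (hne a).symm, hsupp,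
        Finset.card_univ, hev.neg_one_pow] at h1
      by_contra h2
      rw [Nat.not_odd_iff_even] at h2
      rw [h2.neg_one_pow] at h1
      exact absurd h1 (by decide)
    · rw [← hcyc'.orderOf, pow_orderOf_eq_one]

/-! ### Supports and elements concentrated at one index. -/

namespace GenWreath

variable {I : Type*} [PartialOrder I] {G : I → Type*} {Δ : I → Type*}

section Supported

variable [∀ i, Group (G i)] [∀ i, MulAction (G i) (Δ i)] [WellFoundedGT I]

theorem inv_actAbove_actAbove (f : GenWreath G Δ) (i : I) (ω : (j : {j : I // i < j}) → Δ j) :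
    (f⁻¹).actAbove i (f.actAbove i ω) = ω := by
  rw [← mul_actAbove, inv_mul_cancel, one_actAbove]

theorem actAbove_inv_actAbove (f : GenWreath G Δ) (i : I) (ω : (j : {j : I // i < j}) → Δ j) :
    f.actAbove i ((f⁻¹).actAbove i ω) = ω := by
  rw [← mul_actAbove, mul_inv_cancel, one_actAbove]

theorem actAbove_bijective (f : GenWreath G Δ) (i : I) : Function.Bijective (f.actAbove i) :=
  Function.bijective_iff_has_inverse.2
    ⟨_, f.inv_actAbove_actAbove i, f.actAbove_inv_actAbove i⟩

/-- The elements whose components outside `S` are trivial. -/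
def supported (G : I → Type*) (Δ : I → Type*) [∀ i, Group (G i)] [∀ i, MulAction (G i) (Δ i)]
    (S : Finset I) : Subgroup (GenWreath G Δ) where
  carrier := {f | ∀ j ∉ S, ∀ ω, f.comp j ω = 1}
  one_mem' _ _ _ := rfl
  mul_mem' {f h} hf hh j hj ω := by rw [mul_comp, hf j hj, hh j hj, one_mul]
  inv_mem' {f} hf j hj ω := by rw [inv_comp, hf j hj, inv_one]

theorem mem_supported {S : Finset I} {f : GenWreath G Δ} :
    f ∈ supported G Δ S ↔ ∀ j ∉ S, ∀ ω, f.comp j ω = 1 := Iff.rfl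

theorem supported_mono {S T : Finset I} (h : S ⊆ T) : supported G Δ S ≤ supported G Δ T :=
  fun _ hf j hj => hf j fun hj' => hj (h hj')

end Supported

section Single

variable [DecidableEq I] [∀ i, Group (G i)]

theorem mulSingle_comp_of_ne {i j : I} (h : j ≠ i) (φ : ((k : {k : I // i < k}) → Δ k) → G i)
    (ω : (k : {k : I // j < k}) → Δ k) :
    (⟨Pi.mulSingle i φ⟩ : GenWreath G Δ).comp j ω = 1 := by
  simp [Pi.mulSingle_eq_of_ne h]

variable [∀ i, MulAction (G i) (Δ i)]

theorem mulSingle_actAbove {i j : I} (h : ¬ j < i)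
    (φ : ((k : {k : I // i < k}) → Δ k) → G i) (ω : (k : {k : I // j < k}) → Δ k) :
    (⟨Pi.mulSingle i φ⟩ : GenWreath G Δ).actAbove j ω = ω := by
  funext k
  have hk : (k : I) ≠ i := by
    rintro hk
    exact h (hk ▸ k.2)
  rw [actAbove, mulSingle_comp_of_ne hk, one_smul]

variable [WellFoundedGT I]

/-- The elements concentrated at `i`. -/
def single (i : I) : (((k : {k : I // i < k}) → Δ k) → G i) →* GenWreath G Δ where
  toFun φ := ⟨Pi.mulSingle i φ⟩
  map_one' := by
    rw [Pi.mulSingle_one]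
    rfl
  map_mul' φ ψ := by
    ext j ω
    rw [mul_comp]
    by_cases hj : j = i
    · subst hj
      rw [mulSingle_actAbove (lt_irrefl j)]
      simp
    · simp [Pi.mulSingle_eq_of_ne hj]

theorem single_comp_same (i : I) (φ : ((k : {k : I // i < k}) → Δ k) → G i) :
    (single i φ).comp i = φ := by simp [single]

theorem single_comp_of_ne {i j : I} (h : j ≠ i) (φ : ((k : {k : I // i < k}) → Δ k) → G i)
    (ω : (k : {k : I // j < k}) → Δ k) : (single i φ).comp j ω = 1 :=
  mulSingle_comp_of_ne h φ ω

theorem single_actAbove {i j : I} (h : ¬ j < i) (φ : ((k : {k : I // i < k}) → Δ k) → G i)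
    (ω : (k : {k : I // j < k}) → Δ k) : (single i φ).actAbove j ω = ω :=
  mulSingle_actAbove h φ ω

theorem single_mem_supported {i : I} {S : Finset I} (h : i ∈ S)
    (φ : ((k : {k : I // i < k}) → Δ k) → G i) : single i φ ∈ supported G Δ S :=
  fun _ hj => single_comp_of_ne (ne_of_mem_of_not_mem h hj).symm φ

/-- Only components below `i` notice that coordinate `i` has been moved, and there `g` is trivial;
at `i` itself the identity is `h`. -/
theorem mul_single_eq {g : GenWreath G Δ} {i : I} (hg : ∀ j < i, ∀ ω, g.comp j ω = 1)
    {φ ψ : ((k : {k : I // i < k}) → Δ k) → G i}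
    (h : ∀ ω, ψ (g.actAbove i ω) * g.comp i ω = g.comp i ω * φ ω) :
    g * single i φ = single i ψ * g := by
  ext j ω
  rw [mul_comp, mul_comp]
  by_cases hj : j = i
  · subst hj
    rw [single_actAbove (lt_irrefl j), single_comp_same, single_comp_same, h]
  · rw [single_comp_of_ne hj, single_comp_of_ne hj, mul_one, one_mul]
    by_cases hlt : j < i
    · rw [hg j hlt, hg j hlt]
    · rw [single_actAbove hlt]

/-- Every element supported on `insert i S`, where `i` is minimal, is the product of one supported
on `S` and one concentrated at `i`. -/
theorem exists_eq_mul_single {S : Finset I} {i : I} (hmin : ∀ j ∈ S, ¬ j < i) {f : GenWreath G Δ}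
    (hf : f ∈ supported G Δ (insert i S)) :
    ∃ g ∈ supported G Δ (S.erase i), f = g * single i (f.comp i) := by
  refine ⟨⟨Function.update f.comp i 1⟩, fun j hj ω => ?_, ?_⟩
  · by_cases hji : j = i
    · subst hji
      simp
    · have hjS : j ∉ insert i S := by simpa [hji] using hj
      simpa [hji] using hf j hjS ω
  · ext j ω
    rw [mul_comp]
    by_cases hji : j = i
    · subst hji
      rw [single_comp_same]
      simp
    · rw [single_comp_of_ne hji, mul_one]
      simp only [Function.update_of_ne hji]
      by_cases hlt : j < i
      · have hjS : j ∉ insert i S := by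
          simp only [Finset.mem_insert, hji, false_or]
          exact fun h => hmin j h hlt
        rw [hf j hjS, hf j hjS]
      · rw [single_actAbove hlt]

end Single

end GenWreath

/-! ### Elements concentrated at one point. -/

namespace GenWreath

variable {I : Type*} [PartialOrder I] {Δ : I → Type*}

section SingleAt

variable {G : I → Type*} [DecidableEq I] [WellFoundedGT I]
  [∀ i, Group (G i)] [∀ i, MulAction (G i) (Δ i)]

open scoped Classical in
/-- The elements concentrated at `i` and at the point `ω` of `∏_{j > i} Δ j`. -/
noncomputable def singleAt (i : I) (ω : (k : {k : I // i < k}) → Δ k) : G i →* GenWreath G Δ :=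
  (single i).comp (MonoidHom.mulSingle (fun _ => G i) ω)

theorem singleAt_comp_same (i : I) (ω : (k : {k : I // i < k}) → Δ k) (π : G i) :
    (singleAt i ω π).comp i ω = π := by
  simp [singleAt, single_comp_same]

theorem singleAt_comp_of_ne (i : I) {ω ω' : (k : {k : I // i < k}) → Δ k} (h : ω' ≠ ω) (π : G i) :
    (singleAt i ω π).comp i ω' = 1 := by
  classical
  simp [singleAt, single_comp_same, Pi.mulSingle_eq_of_ne h]

theorem mul_singleAt_mul_inv {g : GenWreath G Δ} {i : I} (hg : ∀ j < i, ∀ ω, g.comp j ω = 1)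
    (ω : (k : {k : I // i < k}) → Δ k) (π : G i) :
    g * singleAt i ω π * g⁻¹ =
      singleAt i (g.actAbove i ω) (g.comp i ω * π * (g.comp i ω)⁻¹) := by
  classical
  rw [mul_inv_eq_iff_eq_mul]
  refine mul_single_eq hg fun ω' => ?_
  by_cases h : ω' = ω
  · subst h
    simp
  · have h' : g.actAbove i ω' ≠ g.actAbove i ω := fun e => h ((g.actAbove_bijective i).1 e)
    simp [Pi.mulSingle_eq_of_ne h, Pi.mulSingle_eq_of_ne h']

theorem single_mem_of_forall_singleAt_mem [Finite I] [∀ i, Finite (Δ i)]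
    {H : Subgroup (GenWreath G Δ)} {i : I} (h : ∀ ω π, singleAt i ω π ∈ H)
    (φ : ((k : {k : I // i < k}) → Δ k) → G i) : single i φ ∈ H := by
  classical
  have : φ ∈ H.comap (single i) := Subgroup.pi_mem_of_mulSingle_mem φ fun ω => by
    rw [Subgroup.mem_comap]
    convert h ω (φ ω)
    simp [singleAt]
  exact this

end SingleAt

/-! ### Adding a minimal index. -/

section Symmetric

variable [Finite I]

/-- The group of elements supported on an upper set acts transitively. -/
theorem exists_mem_supported_actAbove_eq {S : Finset I} {i : I} (hup : ∀ j, i < j → j ∈ S)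
    (ω ω' : (k : {k : I // i < k}) → Δ k) :
    ∃ g ∈ supported (fun i => Equiv.Perm (Δ i)) Δ S, g.actAbove i ω = ω' := by
  classical
  refine ⟨⟨fun j _ => if h : i < j then Equiv.swap (ω ⟨j, h⟩) (ω' ⟨j, h⟩) else 1⟩, ?_, ?_⟩
  · intro j hj ω
    exact dif_neg fun h => hj (hup j h)
  · funext j
    have hj : i < (j : I) := j.2
    simp [actAbove, hj]

variable [DecidableEq I] [∀ i, Finite (Δ i)]

/-- One point suffices: elements supported on `S` are trivial at `i`, so conjugating by them carries
`ω` to any other point without changing the permutation placed there. -/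
theorem supported_insert_le {S : Finset I} {i : I} (hi : i ∉ S) (hmin : ∀ j ∈ S, ¬ j < i)
    (hup : ∀ j, i < j → j ∈ S) {H : Subgroup (GenWreath (fun i => Equiv.Perm (Δ i)) Δ)}
    (hS : supported (fun i => Equiv.Perm (Δ i)) Δ S ≤ H)
    {ω : (k : {k : I // i < k}) → Δ k} (hω : ∀ π, singleAt i ω π ∈ H) :
    supported (fun i => Equiv.Perm (Δ i)) Δ (insert i S) ≤ H := by
  have hall : ∀ (ω' : (k : {k : I // i < k}) → Δ k) π, singleAt i ω' π ∈ H := by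
    intro ω' π
    obtain ⟨g, hg, rfl⟩ := exists_mem_supported_actAbove_eq hup ω ω'
    have h := mul_singleAt_mul_inv (g := g) (i := i)
      (fun j hj ω => hg j (fun h => hmin j h hj) ω) ω π
    rw [hg i hi, one_mul, inv_one, mul_one] at h
    rw [← h]
    exact H.mul_mem (H.mul_mem (hS hg) (hω π)) (H.inv_mem (hS hg))
  intro f hf
  obtain ⟨g, hg, hfg⟩ := exists_eq_mul_single hmin hf
  rw [hfg]
  exact H.mul_mem (hS (supported_mono (S.erase_subset i) hg))
    (single_mem_of_forall_singleAt_mem hall _)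

/-- Take the first return time of `ω` under `x`. The product moves points above `i` as `x` does, and
its component at `i` is `c` at `ω` and trivial elsewhere, so along the orbit exactly one factor
contributes. -/
theorem exists_pow_mul_singleAt {x : GenWreath (fun i => Equiv.Perm (Δ i)) Δ} {i : I}
    (hx : ∀ ω, x.comp i ω = 1) (ω : (k : {k : I // i < k}) → Δ k) (c : Equiv.Perm (Δ i)) :
    ∃ n : ℕ, ((x * singleAt i ω c) ^ n).actAbove i ω = ω ∧
      ((x * singleAt i ω c) ^ n).comp i ω = c := by
  classical
  set y := x * singleAt i ω c with hy
  have hact : ∀ ω', y.actAbove i ω' = x.actAbove i ω' := fun ω' => by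
    rw [hy, mul_actAbove]
    exact congrArg _ (single_actAbove (lt_irrefl i) _ _)
  have hpow : ∀ n : ℕ, ∀ ω', (y ^ n).actAbove i ω' = (x ^ n).actAbove i ω' := by
    intro n
    induction n with
    | zero => simp
    | succ n ih =>
      intro ω'
      rw [pow_succ', pow_succ', mul_actAbove x, mul_actAbove y (y ^ n), ih, hact]
  have hcomp : ∀ ω', y.comp i ω' = (singleAt (G := fun i => Equiv.Perm (Δ i)) i ω c).comp i ω' := fun ω' => by
    rw [hy, mul_comp, hx, one_mul]
  have hex : ∃ n : ℕ, 0 < n ∧ (x ^ n).actAbove i ω = ω :=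
    ⟨orderOf x, orderOf_pos x, by rw [pow_orderOf_eq_one, one_actAbove]⟩
  have hmain : ∀ n : ℕ, n + 1 ≤ Nat.find hex → (y ^ (n + 1)).comp i ω = c := by
    intro n
    induction n with
    | zero => intro _; rw [zero_add, pow_one, hcomp, singleAt_comp_same]
    | succ n ih =>
      intro hn
      have hlt : n + 1 < Nat.find hex := hn
      have hne : (x ^ (n + 1)).actAbove i ω ≠ ω := fun h =>
        Nat.find_min hex hlt ⟨n.succ_pos, h⟩
      rw [pow_succ', mul_comp, ih hlt.le, hcomp, hpow, singleAt_comp_of_ne i hne, one_mul]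
  obtain ⟨hpos, hfix⟩ := Nat.find_spec hex
  obtain ⟨m, hm⟩ := Nat.exists_eq_succ_of_ne_zero hpos.ne'
  refine ⟨Nat.find hex, by rw [hpow, hfix], ?_⟩
  have := hmain m hm.ge
  rwa [hm]

variable [∀ i, Nontrivial (Δ i)]

/-- Adding a minimal element to the support costs at most one more generator. -/
theorem exists_closure_eq_supported_insert {S : Finset I} {i : I} (hi : i ∉ S)
    (hmin : ∀ j ∈ S, ¬ j < i) (hup : ∀ j, i < j → j ∈ S)
    {T : Finset (GenWreath (fun i => Equiv.Perm (Δ i)) Δ)} (hT : T.Nonempty)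
    (hTS : Subgroup.closure (T : Set (GenWreath (fun i => Equiv.Perm (Δ i)) Δ)) =
      supported (fun i => Equiv.Perm (Δ i)) Δ S) :
    ∃ T' : Finset (GenWreath (fun i => Equiv.Perm (Δ i)) Δ), T'.Nonempty ∧ T'.card ≤ T.card + 1 ∧
      Subgroup.closure (T' : Set (GenWreath (fun i => Equiv.Perm (Δ i)) Δ)) =
        supported (fun i => Equiv.Perm (Δ i)) Δ (insert i S) := by
  classical
  obtain ⟨x, hxT⟩ := hT
  obtain ⟨c, -, hcne, hcgen⟩ := Equiv.Perm.exists_isCycle_forall_ne (Δ i)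
  obtain ⟨ω⟩ : Nonempty ((k : {k : I // i < k}) → Δ k) := inferInstance
  obtain ⟨a⟩ : Nonempty (Δ i) := inferInstance
  have hTle : ∀ g ∈ T, g ∈ supported (fun i => Equiv.Perm (Δ i)) Δ S := fun g hg => by
    rw [← hTS]
    exact Subgroup.subset_closure hg
  have hsub : ∀ π, singleAt i ω π ∈ supported (fun i => Equiv.Perm (Δ i)) Δ (insert i S) :=
    fun π => single_mem_supported (S.mem_insert_self i) _
  have hTle' : ∀ g ∈ T, g ∈ supported (fun i => Equiv.Perm (Δ i)) Δ (insert i S) :=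
    fun g hg => supported_mono (S.subset_insert i) (hTle g hg)
  set y := x * singleAt i ω c with hy
  set s := singleAt (G := fun i => Equiv.Perm (Δ i)) i ω (Equiv.swap a (c a)) with hs
  have hyS : y ∈ supported (fun i => Equiv.Perm (Δ i)) Δ (insert i S) :=
    Subgroup.mul_mem _ (hTle' x hxT) (hsub c)
  set T' := insert y (insert s (T.erase x)) with hT'
  refine ⟨T', ⟨y, by simp [hT']⟩, ?_, le_antisymm ?_ ?_⟩
  · have h1 := Finset.card_insert_le y (insert s (T.erase x))
    have h2 := Finset.card_insert_le s (T.erase x)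
    have h3 := Finset.card_erase_add_one hxT
    rw [hT']
    omega
  · rw [Subgroup.closure_le]
    intro g hg
    simp only [hT', Finset.coe_insert, Set.mem_insert_iff, Finset.mem_coe, Finset.mem_erase] at hg
    rcases hg with rfl | rfl | hg
    · exact hyS
    · exact hsub _
    · exact hTle' g hg.2
  set H := Subgroup.closure (T' : Set (GenWreath (fun i => Equiv.Perm (Δ i)) Δ)) with hH
  have hyH : y ∈ H := Subgroup.subset_closure (by simp [hT'])
  have hsH : s ∈ H := Subgroup.subset_closure (by simp [hT'])
  obtain ⟨n, hn, hnc⟩ := exists_pow_mul_singleAt (hTle x hxT i hi) ω c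
  have hall : H.comap (singleAt i ω) = ⊤ := by
    -- On the copy of `Sym(Δ i)` at `ω`, conjugation by `y ^ n` is conjugation by `c`.
    refine Subgroup.eq_top_of_swap_mem_of_conj_mem (hcne a).symm (hcgen a) hsH fun π hπ => ?_
    have h := mul_singleAt_mul_inv (g := y ^ n) (i := i)
      (fun j hj => Subgroup.pow_mem _ hyS n j fun h =>
        (Finset.mem_insert.1 h).elim hj.ne fun h => hmin j h hj) ω π
    rw [hn, hnc] at h
    rw [Subgroup.mem_comap, ← h]
    exact H.mul_mem (H.mul_mem (H.pow_mem hyH n) hπ) (H.inv_mem (H.pow_mem hyH n))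
  have hω : ∀ π, singleAt i ω π ∈ H := fun π => by
    rw [← Subgroup.mem_comap, hall]
    trivial
  refine supported_insert_le hi hmin hup ?_ hω
  rw [← hTS, Subgroup.closure_le]
  intro g hg
  by_cases hgx : g = x
  · subst hgx
    have := H.mul_mem hyH (H.inv_mem (hω c))
    simpa [hy] using this
  · exact Subgroup.subset_closure (by simp [hT', hgx, Finset.mem_coe.1 hg])

end Symmetric

end GenWreath

/-! ### Two generators for two indices. -/

namespace GenWreath

variable {I : Type*} [PartialOrder I] {Δ : I → Type*}

section Pair

variable [Finite I] [DecidableEq I]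

/-- The elements whose only nontrivial component, at `t`, is constant. -/
def singleConst (t : I) : Equiv.Perm (Δ t) →* GenWreath (fun i => Equiv.Perm (Δ i)) Δ :=
  (single t).comp (Pi.constMonoidHom _ _)

theorem singleConst_mem_supported {t : I} {S : Finset I} (ht : t ∈ S) (π : Equiv.Perm (Δ t)) :
    singleConst t π ∈ supported (fun i => Equiv.Perm (Δ i)) Δ S :=
  single_mem_supported ht _

theorem supported_singleton_le {t : I} (ht : ∀ j, ¬ t < j)
    {H : Subgroup (GenWreath (fun i => Equiv.Perm (Δ i)) Δ)} (hH : ∀ π, singleConst t π ∈ H) :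
    supported (fun i => Equiv.Perm (Δ i)) Δ {t} ≤ H := by
  intro f hf
  rw [← insert_empty_eq] at hf
  obtain ⟨g, hg, hfg⟩ := exists_eq_mul_single (by simp) hf
  have hg1 : g = 1 := by
    refine GenWreath.ext (funext fun j => funext fun ω => ?_)
    exact hg j (by simp) ω
  have : IsEmpty {j : I // t < j} := ⟨fun j => ht j j.2⟩
  have hconst : f.comp t = Pi.constMonoidHom _ _ (f.comp t isEmptyElim) := by
    funext ω
    exact congrArg _ (Subsingleton.elim _ _)
  rw [hfg, hg1, one_mul, hconst]
  exact hH _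

/-- Since `σ` fixes `p t`, it fixes the supporting point, whether or not `t` lies above `i`. -/
theorem commute_singleConst_singleAt {t i : I} (hti : t ≠ i) (hlt : ¬ t < i) (p : ∀ j, Δ j)
    {σ : Equiv.Perm (Δ t)} (hσ : σ (p t) = p t) (π : Equiv.Perm (Δ i)) :
    Commute (singleConst t σ) (singleAt i (proj i p) π) := by
  have hact : (singleConst t σ).actAbove i (proj i p) = proj i p := by
    funext k
    obtain ⟨k, hk⟩ := k
    by_cases h : k = t
    · subst h
      simpa [actAbove, singleConst, single_comp_same, proj] using hσ
    · rw [actAbove, singleConst, MonoidHom.comp_apply, single_comp_of_ne h, one_smul]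
  have hcomp : ∀ ω, (singleConst t σ).comp i ω = 1 := single_comp_of_ne hti.symm _
  have h := mul_singleAt_mul_inv (g := singleConst t σ) (i := i)
    (fun j hj => single_comp_of_ne (show j ≠ t from fun h => hlt (h ▸ hj)) _) (proj i p) π
  rw [hact, hcomp, one_mul, inv_one, mul_one, mul_inv_eq_iff_eq_mul] at h
  exact h

variable [∀ i, Finite (Δ i)] [∀ i, Nontrivial (Δ i)]

/-- Two generators suffice for a support consisting of a maximal element `t` and another
element `i` which has nothing but possibly `t` above it. -/
theorem exists_closure_eq_supported_pair {t i : I} (hti : t ≠ i) (hlt : ¬ t < i)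
    (ht : ∀ j, ¬ t < j) (hi : ∀ j, i < j → j = t) :
    ∃ T : Finset (GenWreath (fun i => Equiv.Perm (Δ i)) Δ), T.Nonempty ∧ T.card ≤ 2 ∧
      Subgroup.closure (T : Set (GenWreath (fun i => Equiv.Perm (Δ i)) Δ)) =
        supported (fun i => Equiv.Perm (Δ i)) Δ (insert i {t}) := by
  classical
  have hi' : i ∉ ({t} : Finset I) := by simpa using hti.symm
  have hmin : ∀ j ∈ ({t} : Finset I), ¬ j < i := by simpa using hlt
  have hup : ∀ j, i < j → j ∈ ({t} : Finset I) := by simpa using hi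
  obtain ⟨ρ, hρ, hρne, hρgen⟩ := Equiv.Perm.exists_isCycle_forall_ne (Δ t)
  obtain ⟨p⟩ : Nonempty (∀ j, Δ j) := inferInstance
  -- This is the case of a two-point `Δ t`, where `ρ` alone generates.
  by_cases h2 : ρ (ρ (p t)) = p t
  · have hgen : Subgroup.closure {ρ} = ⊤ := by
      have h := hρgen (p t)
      rwa [← hρ.eq_swap_of_apply_apply_eq_self (hρne _) h2, Set.pair_eq_singleton] at h
    obtain ⟨T, hT, hcard, hcl⟩ := exists_closure_eq_supported_insert hi' hmin hup
      (T := {singleConst t ρ}) (by simp) (by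
        rw [Finset.coe_singleton]
        refine le_antisymm ?_ (supported_singleton_le ht fun π => ?_)
        · simpa using singleConst_mem_supported (by simp) ρ
        · have hπ : π ∈ Subgroup.closure {ρ} := hgen ▸ Subgroup.mem_top π
          have := Subgroup.mem_map_of_mem (singleConst t) hπ
          rwa [MonoidHom.map_closure, Set.image_singleton] at this)
    exact ⟨T, hT, by simpa using hcard, hcl⟩
  obtain ⟨c, τ, n, hn, hcn, hcgen⟩ := Equiv.Perm.exists_odd_order_generating_pair (Δ i)
  set σ := Equiv.swap (ρ (p t)) (ρ (ρ (p t))) with hσdef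
  have hσ : σ (p t) = p t := Equiv.swap_apply_of_ne_of_ne (hρne _).symm (Ne.symm h2)
  -- The two factors commute because `σ` fixes `p t`; an odd power kills `c` and preserves the
  -- involution `σ`.
  set x := singleConst t σ * singleAt i (proj i p) c with hx
  set y := singleConst t ρ * singleAt i (proj i p) τ with hy
  set H := Subgroup.closure ({x, y} : Set (GenWreath (fun i => Equiv.Perm (Δ i)) Δ)) with hH
  have hxH : x ∈ H := Subgroup.subset_closure (by simp)
  have hyH : y ∈ H := Subgroup.subset_closure (by simp)
  have hσH : singleConst t σ ∈ H := by
    have h : x ^ n = singleConst t σ := by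
      have hσn : σ ^ n = σ := by
        obtain ⟨m, rfl⟩ := hn
        rw [pow_succ, pow_mul, pow_two, hσdef, Equiv.swap_mul_self, one_pow, one_mul]
      rw [hx, (commute_singleConst_singleAt hti hlt p hσ c).mul_pow, ← map_pow, ← map_pow, hcn,
        map_one, mul_one, hσn]
    exact h ▸ H.pow_mem hxH n
  have hcH : singleAt i (proj i p) c ∈ H := by
    have := H.mul_mem (H.inv_mem hσH) hxH
    simpa [hx] using this
  -- A transposition avoiding `p t` commutes with the `τ` factor of `y`, so `y` conjugates it as `ρ`
  -- does. Starting from `σ`, this reaches every adjacent transposition except the one joining `p t`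
  -- to `ρ (p t)`; those reached form a path through all of `Δ t`.
  have hconj : ∀ q, q ≠ p t → ρ q ≠ p t → singleConst t (Equiv.swap q (ρ q)) ∈ H →
      singleConst t (Equiv.swap (ρ q) (ρ (ρ q))) ∈ H := by
    intro q hq hρq hmem
    have hcomm := commute_singleConst_singleAt hti hlt p
      (Equiv.swap_apply_of_ne_of_ne hq.symm hρq.symm) τ
    have h : singleConst t (Equiv.swap (ρ q) (ρ (ρ q))) =
        y * singleConst t (Equiv.swap q (ρ q)) * y⁻¹ := by
      rw [Equiv.swap_apply_apply, map_mul, map_mul, map_inv, eq_mul_inv_iff_mul_eq, hy,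
        mul_assoc _ _ (singleConst t (Equiv.swap q (ρ q))), ← hcomm.eq]
      group
    rw [h]
    exact H.mul_mem (H.mul_mem hyH hmem) (H.inv_mem hyH)
  have hadj : ∀ n : ℕ, (ρ ^ (n + 1)) (p t) ≠ p t →
      singleConst t (Equiv.swap ((ρ ^ (n + 1)) (p t)) (ρ ((ρ ^ (n + 1)) (p t)))) ∈ H := by
    intro n
    induction n with
    | zero => intro _; simpa using hσH
    | succ n ih =>
      rw [pow_succ' ρ (n + 1), Equiv.Perm.mul_apply]
      intro hne
      -- When the walk passes `p t`, it restarts at `σ`.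
      by_cases h : (ρ ^ (n + 1)) (p t) = p t
      · rw [h]
        exact hσH
      · exact hconj _ h hne (ih h)
  set M := H.comap (singleConst t) with hM
  have hstar : ∀ n : ℕ, Equiv.swap (ρ (p t)) ((ρ ^ (n + 1)) (p t)) ∈ M := by
    intro n
    induction n with
    | zero => simp [M.one_mem, ← Equiv.Perm.one_def]
    | succ n ih =>
      rw [pow_succ' ρ (n + 1), Equiv.Perm.mul_apply]
      by_cases h : (ρ ^ (n + 1)) (p t) = p t
      · rw [h, Equiv.swap_self]
        exact M.one_mem
      · exact SubmonoidClass.swap_mem_trans M ih (hadj n h)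
  have hstar' : ∀ q, Equiv.swap (ρ (p t)) q ∈ M := by
    intro q
    obtain ⟨n, hn⟩ := hρ.exists_pow_eq (hρne (ρ (p t))) (hρne q)
    have := hstar n
    rwa [pow_succ, Equiv.Perm.mul_apply, hn] at this
  have hMtop : M = ⊤ := by
    rw [eq_top_iff, ← Equiv.Perm.closure_isSwap, Subgroup.closure_le]
    rintro _ ⟨a, b, -, rfl⟩
    exact SubmonoidClass.swap_mem_trans M (Equiv.swap_comm _ a ▸ hstar' a) (hstar' b)
  have hconst : ∀ π, singleConst t π ∈ H := fun π => by
    rw [← Subgroup.mem_comap, ← hM, hMtop]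
    trivial
  have hτH : singleAt i (proj i p) τ ∈ H := by
    have := H.mul_mem (H.inv_mem (hconst ρ)) hyH
    simpa [hy] using this
  have hat : ∀ π, singleAt i (proj i p) π ∈ H := by
    have : H.comap (singleAt i (proj i p)) = ⊤ := by
      rw [eq_top_iff, ← hcgen, Subgroup.closure_le]
      rintro _ (rfl | rfl)
      exacts [hcH, hτH]
    intro π
    rw [← Subgroup.mem_comap, this]
    trivial
  refine ⟨{x, y}, by simp, Finset.card_le_two, le_antisymm ?_ ?_⟩
  · rw [Subgroup.closure_le]
    have h1 : ∀ π, singleConst t π ∈ supported (fun i => Equiv.Perm (Δ i)) Δ (insert i {t}) :=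
      singleConst_mem_supported (by simp)
    have h2 : ∀ π, singleAt i (proj i p) π ∈
        supported (fun i => Equiv.Perm (Δ i)) Δ (insert i {t}) :=
      fun π => single_mem_supported (by simp) _
    intro g hg
    rcases (by simpa using hg : g = x ∨ g = y) with rfl | rfl
    · exact Subgroup.mul_mem _ (h1 σ) (h2 c)
    · exact Subgroup.mul_mem _ (h1 ρ) (h2 τ)
  · rw [Finset.coe_pair]
    exact supported_insert_le hi' hmin hup (supported_singleton_le ht hconst) hat

theorem exists_closure_eq_supported (n : ℕ) (S : Finset I) (hS : S.card = n + 2)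
    (hup : ∀ i ∈ S, ∀ j, i < j → j ∈ S) :
    ∃ T : Finset (GenWreath (fun i => Equiv.Perm (Δ i)) Δ), T.Nonempty ∧ T.card ≤ n + 2 ∧
      Subgroup.closure (T : Set (GenWreath (fun i => Equiv.Perm (Δ i)) Δ)) =
        supported (fun i => Equiv.Perm (Δ i)) Δ S := by
  induction n generalizing S with
  | zero =>
    obtain ⟨i, hiS, himin⟩ := S.exists_minimal (Finset.card_pos.1 (by omega))
    obtain ⟨t, ht⟩ := Finset.card_eq_one.1
      (show (S.erase i).card = 1 by rw [Finset.card_erase_of_mem hiS, hS])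
    have htS : t ∈ S.erase i := by simp [ht]
    have hti : t ≠ i := Finset.ne_of_mem_erase htS
    have htS' : t ∈ S := Finset.mem_of_mem_erase htS
    have hlt : ¬ t < i := fun h => h.not_ge (himin htS' h.le)
    have hmem : ∀ j ∈ S, j ≠ i → j = t := fun j hj hji => by
      have : j ∈ S.erase i := Finset.mem_erase.2 ⟨hji, hj⟩
      simpa [ht] using this
    rw [← Finset.insert_erase hiS, ht]
    refine exists_closure_eq_supported_pair hti hlt (fun j hj => ?_) fun j hj => ?_
    · refine hj.ne' (hmem j (hup t htS' j hj) ?_)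
      rintro rfl
      exact hlt hj
    · exact hmem j (hup i hiS j hj) hj.ne'
  | succ n ih =>
    obtain ⟨i, hiS, himin⟩ := S.exists_minimal (Finset.card_pos.1 (by omega))
    have hmin : ∀ j ∈ S.erase i, ¬ j < i := fun j hj h =>
      h.not_ge (himin (Finset.mem_of_mem_erase hj) h.le)
    obtain ⟨T, hT, hcard, hcl⟩ := ih (S.erase i) (by rw [Finset.card_erase_of_mem hiS, hS]; rfl)
      (fun j hj k hjk => Finset.mem_erase.2 ⟨by rintro rfl; exact hmin j hj hjk,
        hup j (Finset.mem_of_mem_erase hj) k hjk⟩)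
    obtain ⟨T', hT', hcard', hcl'⟩ := exists_closure_eq_supported_insert (S.notMem_erase i) hmin
      (fun j hj => Finset.mem_erase.2 ⟨hj.ne', hup i hiS j hj⟩) hT hcl
    rw [Finset.insert_erase hiS] at hcl'
    exact ⟨T', hT', by omega, hcl'⟩

end Pair

/-! ### Signs and the lower bound. -/

section Sign

variable [Finite I] [∀ i, Finite (Δ i)]

open scoped Classical in
/-- The product of the signs of all the values of the component at `i`. -/
noncomputable def signAt (i : I) : GenWreath (fun i => Equiv.Perm (Δ i)) Δ →* ℤˣ :=
  letI := Fintype.ofFinite (Δ i)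
  letI := Fintype.ofFinite ((k : {k : I // i < k}) → Δ k)
  { toFun f := ∏ ω, Equiv.Perm.sign (f.comp i ω)
    map_one' := by simp [one_comp]
    map_mul' f h := by
      simp only [mul_comp, Equiv.Perm.sign_mul, Finset.prod_mul_distrib]
      congr 1
      exact (h.actAbove_bijective i).prod_comp fun ω => Equiv.Perm.sign (f.comp i ω) }

theorem pi_signAt_surjective [∀ i, Nontrivial (Δ i)] :
    Function.Surjective (MonoidHom.pi (signAt (Δ := Δ))) := by
  classical
  intro u
  obtain ⟨p⟩ : Nonempty (∀ j, Δ j) := inferInstance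
  choose q hq using fun j => exists_ne (p j)
  -- One transposition, at a single point, for each index where the sign must be -1.
  refine ⟨⟨fun i ω => if ω = proj i p ∧ u i = -1 then Equiv.swap (p i) (q i) else 1⟩, ?_⟩
  funext i
  let := Fintype.ofFinite (Δ i)
  let := Fintype.ofFinite ((k : {k : I // i < k}) → Δ k)
  simp only [MonoidHom.pi_apply, signAt, MonoidHom.coe_mk, OneHom.coe_mk]
  rw [Finset.prod_eq_single (proj i p) (fun ω _ hω => by simp [hω]) (by simp)]
  rcases Int.units_eq_one_or (u i) with h | h
  · rw [h, if_neg (by simp), map_one]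
  · rw [h, if_pos (by simp), Equiv.Perm.sign_swap (hq i).symm]

end Sign

end GenWreath

theorem theorem1 {I : Type*} [PartialOrder I] [Finite I] (hI : 2 ≤ Nat.card I)
    (Δ : I → Type*) [∀ i, Finite (Δ i)] [∀ i, Nontrivial (Δ i)] :
    Group.rank (GenWreath (fun i => Equiv.Perm (Δ i)) Δ) = Nat.card I := by
  classical
  have := Fintype.ofFinite I
  apply le_antisymm
  · obtain ⟨n, hn⟩ := Nat.exists_eq_add_of_le' hI
    obtain ⟨T, -, hcard, hcl⟩ := GenWreath.exists_closure_eq_supported (Δ := Δ) n Finset.univ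
      (by rw [Finset.card_univ, ← Nat.card_eq_fintype_card, hn]) (by simp)
    rw [hn]
    refine (Group.rank_le (hcl.trans ?_)).trans hcard
    exact eq_top_iff.2 fun f _ j hj => absurd (Finset.mem_univ j) hj
  · refine le_trans ?_ (Group.rank_le_of_surjective _ (GenWreath.pi_signAt_surjective (Δ := Δ)))
    -- The target has exponent dividing 2, so its order 2^|I| divides 2 to the power of its rank.
    have h := card_dvd_exponent_pow_rank' (I → ℤˣ) (n := 2) fun u => by
      funext i
      exact Int.units_sq (u i)
    rw [Nat.card_fun, Nat.card_eq_fintype_card (α := ℤˣ), Fintype.card_units_int] at h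
    exact (Nat.pow_dvd_pow_iff_le_right one_lt_two).1 h
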